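/- Let $n\ge 1$ and $m\ge n+2$ be integers, let $V_1,\dots,V_m$ be independent $\mathbb R^n$-valued random vectors with law $\mathcal N(0,I_n)$, and let $W$ be a random variable with values in the space $\mathfrak{so}(n)$ of real skew-symmetric $n\times n$ matrices, independent of $(V_1,\dots,V_m)$. For column vectors $u,v\in\mathbb R^n$ put $u\odot v:=uv^t-vu^t\in\mathfrak{so}(n)$; let $\mathscr V$ be the $n\times m$ matrix with columns $V_1,\dots,V_m$, let $\mathscr W=W$ regarded as an $n\times n$ matrix, and let $\|\cdot\|$ be the Hilbert-Schmidt norm of matrices. Then $\mathscr V\mathscr V^t$ is almost surely invertible, and the columns $U_1,\dots,U_m$ of the $n\times m$ random matrix $\mathscr U$ given by $$\mathscr U^t=-\tfrac12\,\mathscr V^t\left(\mathscr V\mathscr V^t\right)^{-1}\mathscr W$$ are random vectors which satisfy, almost surely, $$\sum_{k=1}^m U_k\odot V_k=W.$$ Moreover, for every real $q$ with $0<q\le 2$, $$\mathbb E\left[\|\mathscr U\|^q\right]\le\frac1{2^q n^{q/2}}\,\mathbb E\left[\operatorname{tr}\left((\mathscr V\mathscr V^t)^{-1}\right)^{q/2}\right]\mathbb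 E\left[\|\mathscr W\|^q\right],$$ and in particular $$\mathbb E\left[\|\mathscr U\|^2\right]\le\frac1{4(m-n-1)}\,\mathbb E\left[\|\mathscr W\|^2\right],$$ where the expectations are taken in $[0,\infty]$. -/

import Mathlib

open MeasureTheory ProbabilityTheory Matrix

-- The Hilbert-Schmidt (Frobenius) norm is the norm used on real matrices.
attribute [local instance] Matrix.frobeniusNormedAddCommGroup

/-- The product (entrywise) σ-algebra on real matrices, which is their Borel σ-algebra. -/
instance matrixMeasurableSpace {n m : ℕ} : MeasurableSpace (Matrix (Fin n) (Fin m) ℝ) :=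
  inferInstanceAs (MeasurableSpace (Fin n → Fin m → ℝ))

/-- `u ⊙ v = u vᵗ - v uᵗ`, a skew-symmetric matrix of size `n`. -/
def odot {n : ℕ} (u v : EuclideanSpace ℝ (Fin n)) : Matrix (Fin n) (Fin n) ℝ :=
  Matrix.vecMulVec u v - Matrix.vecMulVec v u

/-- The `n × m` matrix whose columns are the vectors `V 0, …, V (m - 1)` of `ℝⁿ`. -/
def colMatrix {n m : ℕ} (V : Fin m → EuclideanSpace ℝ (Fin n)) : Matrix (Fin n) (Fin m) ℝ :=
  Matrix.of fun i k => V k i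

/-- The `n × m` matrix `𝒰` defined by `𝒰ᵗ = -(1/2) 𝒱ᵗ (𝒱 𝒱ᵗ)⁻¹ 𝒲`. -/
noncomputable def sylvesterMatrix {n m : ℕ} (A : Matrix (Fin n) (Fin m) ℝ)
    (W : Matrix (Fin n) (Fin n) ℝ) : Matrix (Fin n) (Fin m) ℝ :=
  (-(1 / 2 : ℝ) • (Aᵀ * (A * Aᵀ)⁻¹ * W))ᵀ

/-- The columns `U 0, …, U (m - 1)` of the matrix `𝒰` built from the vectors `V k` and `W`. -/
noncomputable def sylvesterSol {n m : ℕ} (V : Fin m → EuclideanSpace ℝ (Fin n))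
    (W : Matrix (Fin n) (Fin n) ℝ) : Fin m → EuclideanSpace ℝ (Fin n) :=
  fun k => WithLp.toLp 2 fun j => sylvesterMatrix (colMatrix V) W j k

/-! Write `A` for the Gaussian matrix and `G = A Aᵗ`. Skew-symmetry of `W` turns `A 𝒰ᵗ = -W/2` into
`𝒰 Aᵗ = W/2`, which solves the equation wherever `G` is invertible. Also `‖𝒰‖² = tr(G⁻¹ W Wᵗ) / 4`,
so everything reduces to moments of `tr(G⁻¹ S)` with `S = W Wᵗ` frozen by independence.

Since the law of `A` is invariant under left rotations, `S` may be diagonalised with its eigenvalues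
in any cyclic order. Averaging over the `n` orders and using concavity of `t ↦ t^(q/2)` replaces `S`
by `(tr S / n) I` (`lintegral_trace_inv_gram_mul_rpow_le`).

For `q = 2` one needs `E tr G⁻¹ ≤ n / (m - n - 1)`. Gaussian integration by parts is applied to the
bounded field `B A`, where `B = (G + ε)⁻¹`: the expectation of `⟨A, B A⟩ ≤ n` equals that of its
divergence, `(m - n - 1) tr B` plus nonnegative multiples of `ε` (`sum_ridgeDeriv`). Fatou as `ε →
0` gives the bound. One of the extra terms blows up where `G` is singular, so the same estimate
gives almost sure invertibility. -/

/-! ### Algebra and bounds for the regularised inverse. -/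

section RidgeInverse

variable {ι κ : Type*} [Fintype ι] [Fintype κ] [DecidableEq ι]

/-- The regularised inverse Gram matrix `(A Aᵗ + ε)⁻¹`. -/
noncomputable def ridgeInv (ε : ℝ) (A : Matrix ι κ ℝ) : Matrix ι ι ℝ :=
  (A * Aᵀ + ε • (1 : Matrix ι ι ℝ))⁻¹

lemma posDef_gram_add {ε : ℝ} (hε : 0 < ε) (A : Matrix ι κ ℝ) :
    (A * Aᵀ + ε • (1 : Matrix ι ι ℝ)).PosDef := by
  have h := posSemidef_self_mul_conjTranspose A
  rw [conjTranspose_eq_transpose_of_trivial] at h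
  exact PosDef.posSemidef_add h (PosDef.one.smul hε)

lemma posDef_ridgeInv {ε : ℝ} (hε : 0 < ε) (A : Matrix ι κ ℝ) : (ridgeInv ε A).PosDef :=
  (posDef_gram_add hε A).inv

lemma transpose_ridgeInv {ε : ℝ} (hε : 0 < ε) (A : Matrix ι κ ℝ) :
    (ridgeInv ε A)ᵀ = ridgeInv ε A := by
  have h := (posDef_ridgeInv hε A).1.eq
  rwa [conjTranspose_eq_transpose_of_trivial] at h

lemma gram_mul_ridgeInv {ε : ℝ} (hε : 0 < ε) (A : Matrix ι κ ℝ) :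
    A * Aᵀ * ridgeInv ε A = 1 - ε • ridgeInv ε A := by
  have h : (A * Aᵀ + ε • (1 : Matrix ι ι ℝ)) * ridgeInv ε A = 1 :=
    mul_nonsing_inv _ ((isUnit_iff_isUnit_det _).1 (posDef_gram_add hε A).isUnit)
  rw [add_mul, smul_mul_assoc, one_mul] at h
  rw [← h, add_sub_cancel_right]

lemma trace_transpose_ridgeInv_mul {ε : ℝ} (hε : 0 < ε) (A : Matrix ι κ ℝ) :
    (Aᵀ * ridgeInv ε A * A).trace = Fintype.card ι - ε * (ridgeInv ε A).trace := by
  rw [trace_mul_comm, ← Matrix.mul_assoc, gram_mul_ridgeInv hε]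
  simp

lemma trace_ridgeInv_mul_mul_transpose {ε : ℝ} (hε : 0 < ε) (A : Matrix ι κ ℝ) :
    ((ridgeInv ε A * A) * (ridgeInv ε A * A)ᵀ).trace =
      (ridgeInv ε A).trace - ε * (ridgeInv ε A * (ridgeInv ε A)ᵀ).trace := by
  rw [transpose_mul, transpose_ridgeInv hε, Matrix.mul_assoc, ← Matrix.mul_assoc A,
    gram_mul_ridgeInv hε]
  simp [Matrix.mul_sub]

omit [DecidableEq ι] in
lemma trace_mul_transpose_self (M : Matrix ι κ ℝ) :
    (M * Mᵀ).trace = ∑ i, ∑ k, M i k ^ 2 := by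
  simp [trace, mul_apply, sq]

lemma diag_transpose_ridgeInv_nonneg {ε : ℝ} (hε : 0 < ε) (A : Matrix ι κ ℝ) (k : κ) :
    0 ≤ (Aᵀ * ridgeInv ε A * A) k k := by
  have h := (posDef_ridgeInv hε A).posSemidef.conjTranspose_mul_mul_same A
  rw [conjTranspose_eq_transpose_of_trivial] at h
  exact h.diag_nonneg

lemma trace_ridgeInv_nonneg {ε : ℝ} (hε : 0 < ε) (A : Matrix ι κ ℝ) :
    0 ≤ (ridgeInv ε A).trace :=
  (posDef_ridgeInv hε A).posSemidef.trace_nonneg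

lemma trace_ridgeInv_le {ε : ℝ} (hε : 0 < ε) (A : Matrix ι κ ℝ) :
    (ridgeInv ε A).trace ≤ Fintype.card ι / ε := by
  have h : 0 ≤ (Aᵀ * ridgeInv ε A * A).trace :=
    Finset.sum_nonneg fun k _ => diag_transpose_ridgeInv_nonneg hε A k
  rw [trace_transpose_ridgeInv_mul hε] at h
  rw [le_div_iff₀ hε]
  linarith

lemma diag_transpose_ridgeInv_le {ε : ℝ} (hε : 0 < ε) (A : Matrix ι κ ℝ) (k : κ) :
    (Aᵀ * ridgeInv ε A * A) k k ≤ Fintype.card ι := by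
  have h : (Aᵀ * ridgeInv ε A * A) k k ≤ (Aᵀ * ridgeInv ε A * A).trace :=
    Finset.single_le_sum (f := fun k => (Aᵀ * ridgeInv ε A * A) k k)
      (fun k _ => diag_transpose_ridgeInv_nonneg hε A k) (Finset.mem_univ k)
  rw [trace_transpose_ridgeInv_mul hε] at h
  nlinarith [trace_ridgeInv_nonneg hε A]

lemma diag_ridgeInv_nonneg {ε : ℝ} (hε : 0 < ε) (A : Matrix ι κ ℝ) (i : ι) :
    0 ≤ ridgeInv ε A i i :=
  (posDef_ridgeInv hε A).posSemidef.diag_nonneg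

lemma diag_ridgeInv_le {ε : ℝ} (hε : 0 < ε) (A : Matrix ι κ ℝ) (i : ι) :
    ridgeInv ε A i i ≤ Fintype.card ι / ε :=
  (Finset.single_le_sum (f := fun i => ridgeInv ε A i i)
    (fun i _ => diag_ridgeInv_nonneg hε A i) (Finset.mem_univ i)).trans (trace_ridgeInv_le hε A)

/-- With `B` the regularised inverse, the squared entries of `B A` sum to `tr B - ε tr(B Bᵗ) ≤ tr
B`. The bound degenerates as `ε → 0`, but it only serves integrability at fixed `ε`. -/
lemma sq_ridgeInv_mul_le {ε : ℝ} (hε : 0 < ε) (A : Matrix ι κ ℝ) (i : ι) (k : κ) :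
    (ridgeInv ε A * A) i k ^ 2 ≤ Fintype.card ι / ε := by
  have h1 : (ridgeInv ε A * A) i k ^ 2 ≤ ∑ i, ∑ k, (ridgeInv ε A * A) i k ^ 2 :=
    (Finset.single_le_sum (f := fun k => (ridgeInv ε A * A) i k ^ 2)
      (fun _ _ => sq_nonneg _) (Finset.mem_univ k)).trans
    (Finset.single_le_sum (f := fun i => ∑ k, (ridgeInv ε A * A) i k ^ 2)
      (fun _ _ => Finset.sum_nonneg fun _ _ => sq_nonneg _) (Finset.mem_univ i))
  rw [← trace_mul_transpose_self, trace_ridgeInv_mul_mul_transpose hε,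
    trace_mul_transpose_self] at h1
  have h2 : 0 ≤ ∑ i, ∑ k, ridgeInv ε A i k ^ 2 :=
    Finset.sum_nonneg fun _ _ => Finset.sum_nonneg fun _ _ => sq_nonneg _
  nlinarith [trace_ridgeInv_le hε A]

/-- The derivative of the `(i, k)` entry of `(A Aᵗ + ε)⁻¹ A` in the direction of the `(i, k)`
entry of `A`. -/
noncomputable def ridgeDeriv (ε : ℝ) (A : Matrix ι κ ℝ) (i : ι) (k : κ) : ℝ :=
  ridgeInv ε A i i - ridgeInv ε A i i * (Aᵀ * ridgeInv ε A * A) k k - (ridgeInv ε A * A) i k ^ 2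

lemma abs_ridgeDeriv_le {ε : ℝ} (hε : 0 < ε) (A : Matrix ι κ ℝ) (i : ι) (k : κ) :
    |ridgeDeriv ε A i k| ≤ Fintype.card ι / ε * (Fintype.card ι + 1) := by
  have h1 := diag_ridgeInv_nonneg hε A i
  have h2 := diag_ridgeInv_le hε A i
  have h3 := diag_transpose_ridgeInv_nonneg hε A k
  have h4 := diag_transpose_ridgeInv_le hε A k
  have h5 := sq_ridgeInv_mul_le hε A i k
  have h6 := sq_nonneg ((ridgeInv ε A * A) i k)
  have h7 := mul_le_mul h2 h4 h3 (h1.trans h2)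
  have h8 := mul_nonneg h1 h3
  have h9 := mul_nonneg (h1.trans h2) (h3.trans h4)
  rw [ridgeDeriv, abs_le]
  constructor <;> linarith

/-- The three terms of `ridgeDeriv` sum to `m tr B`, `tr B · (n - ε tr B)` and `tr B - ε tr(B Bᵗ)`,
where `n` and `m` count rows and columns; hence the factor `m - n - 1`. -/
lemma sum_ridgeDeriv {ε : ℝ} (hε : 0 < ε) (A : Matrix ι κ ℝ) :
    ∑ k, ∑ i, ridgeDeriv ε A i k =
      (Fintype.card κ - Fintype.card ι - 1) * (ridgeInv ε A).trace +
        ε * (ridgeInv ε A).trace ^ 2 + ε * (ridgeInv ε A * (ridgeInv ε A)ᵀ).trace := by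
  have h1 := trace_transpose_ridgeInv_mul hε A
  have h2 := trace_ridgeInv_mul_mul_transpose hε A
  rw [trace_mul_transpose_self] at h2
  have h3 : ∀ k, ∑ i, ridgeDeriv ε A i k = (ridgeInv ε A).trace -
      (ridgeInv ε A).trace * (Aᵀ * ridgeInv ε A * A) k k - ∑ i, (ridgeInv ε A * A) i k ^ 2 := by
    intro k
    simp only [ridgeDeriv, Finset.sum_sub_distrib, ← Finset.sum_mul]
    rfl
  simp only [h3, Finset.sum_sub_distrib, ← Finset.mul_sum, Finset.sum_const, Finset.card_univ,
    nsmul_eq_mul]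
  rw [Finset.sum_comm, h2]
  change _ - _ * (Aᵀ * ridgeInv ε A * A).trace - _ = _
  rw [h1]
  ring

end RidgeInverse

/-! ### Differentiating the regularised inverse. -/

section Derivative

variable {ι κ : Type*} [Fintype ι] [Fintype κ] [DecidableEq ι]

-- Differentiability of inversion requires a normed algebra; the Frobenius structure provides one in
-- which derivatives can still be read entrywise.
attribute [local instance] Matrix.frobeniusNormedRing Matrix.frobeniusNormedAlgebra in
lemma hasDerivAt_matrix_inv {M : ℝ → Matrix ι ι ℝ} {M' : Matrix ι ι ℝ} {t : ℝ}
    (hM : ∀ i j, HasDerivAt (fun s => M s i j) (M' i j) t) (hu : IsUnit (M t)) (i j : ι) :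
    HasDerivAt (fun s => (M s)⁻¹ i j) (-((M t)⁻¹ * M' * (M t)⁻¹) i j) t := by
  have h1 : HasDerivAt M M' t := hasDerivAt_pi.2 fun i => hasDerivAt_pi.2 fun j => hM i j
  obtain ⟨u, hu⟩ := hu
  have h2 := hasFDerivAt_ringInverse (𝕜 := ℝ) u
  rw [hu] at h2
  have h3 := h2.comp_hasDerivAt t h1
  have h4 := hasDerivAt_pi.1 (hasDerivAt_pi.1 h3 i) j
  have h5 : (↑u⁻¹ : Matrix ι ι ℝ) = (M t)⁻¹ := by rw [← hu, coe_units_inv]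
  rw [h5] at h4
  simpa [nonsing_inv_eq_ringInverse, Function.comp_def] using h4

lemma mul_single_one_mul_apply [DecidableEq κ] {α β : Type*} (P : Matrix α ι ℝ) (Q : Matrix κ β ℝ)
    (i : ι) (k : κ) (a : α) (b : β) :
    (P * Matrix.single i k (1 : ℝ) * Q) a b = P a i * Q k b := by
  simp [mul_apply, Matrix.single, ite_and]

/-- The derivative of an entry of `(A Aᵗ + ε)⁻¹ A` along the same entry of `A`. -/
lemma hasDerivAt_ridgeInv_mul [DecidableEq κ] {ε : ℝ} (hε : 0 < ε) {c : ℝ → Matrix ι κ ℝ} {t : ℝ}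
    {i : ι} {k : κ}
    (hc : ∀ a b, HasDerivAt (fun s => c s a b) (Matrix.single i k (1 : ℝ) a b) t) :
    HasDerivAt (fun s => (ridgeInv ε (c s) * c s) i k) (ridgeDeriv ε (c t) i k) t := by
  set E : Matrix ι κ ℝ := Matrix.single i k 1 with hE
  have hM : ∀ a b, HasDerivAt (fun s => (c s * (c s)ᵀ + ε • (1 : Matrix ι ι ℝ)) a b)
      ((E * (c t)ᵀ + c t * Eᵀ) a b) t := by
    intro a b
    have h := (HasDerivAt.fun_sum (u := Finset.univ)
      fun l _ => (hc a l).mul (hc b l)).add_const (ε • (1 : Matrix ι ι ℝ) a b)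
    refine (h.congr_deriv ?_)
    simp [mul_apply, Finset.sum_add_distrib]
  have hB := hasDerivAt_matrix_inv hM (posDef_gram_add hε (c t)).isUnit
  have h := HasDerivAt.fun_sum (u := Finset.univ) fun l _ => (hB i l).mul (hc l k)
  refine h.congr_deriv ?_
  change ∑ l, ((-(ridgeInv ε (c t) * (E * (c t)ᵀ + c t * Eᵀ) * ridgeInv ε (c t))) i l * c t l k +
    ridgeInv ε (c t) i l * E l k) = _
  rw [Finset.sum_add_distrib]
  simp only [← mul_apply]
  set B := ridgeInv ε (c t)
  have h1 : (B * E) i k = B i i := by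
    have := mul_single_one_mul_apply B (1 : Matrix κ κ ℝ) i k i k
    rwa [Matrix.mul_one, one_apply_eq, mul_one] at this
  -- Since `E` is a matrix unit, the `(i, k)` entries of the two products factor as `B i i * (Aᵗ B
  -- A) k k` and `(B A) i k ^ 2`.
  have h2 : -(B * (E * (c t)ᵀ + c t * Eᵀ) * B) * c t =
      -(B * E * ((c t)ᵀ * B * c t)) - B * c t * Eᵀ * (B * c t) := by
    simp only [Matrix.mul_add, Matrix.add_mul, Matrix.neg_mul, Matrix.mul_assoc]
    abel
  rw [h2, h1, Matrix.sub_apply, Matrix.neg_apply, hE, transpose_single, mul_single_one_mul_apply,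
    mul_single_one_mul_apply, ridgeDeriv]
  ring

end Derivative

/-! ### Gaussian integration by parts, on the line and in one matrix entry. -/

section Stein

lemma hasDerivAt_gaussianPDFReal (x : ℝ) :
    HasDerivAt (gaussianPDFReal 0 1) (-(x * gaussianPDFReal 0 1 x)) x := by
  have h : gaussianPDFReal 0 1 = fun x : ℝ =>
      (Real.sqrt (2 * Real.pi))⁻¹ * Real.exp (-x ^ 2 / 2) := by
    ext x; simp [gaussianPDFReal]
  rw [h]
  have h1 : HasDerivAt (fun x : ℝ => -x ^ 2 / 2) (-x) x := by
    refine (((hasDerivAt_id x).pow 2).neg.div_const 2).congr_deriv ?_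
    simp
    ring
  refine (h1.exp.const_mul (Real.sqrt (2 * Real.pi))⁻¹).congr_deriv ?_
  ring

lemma integrable_mul_gaussianPDFReal : Integrable fun x : ℝ => x * gaussianPDFReal 0 1 x := by
  have h := (integrable_mul_exp_neg_mul_sq (b := 1 / 2) (by norm_num)).const_mul
    (Real.sqrt (2 * Real.pi))⁻¹
  refine h.congr (ae_of_all _ fun x => ?_)
  simp only [gaussianPDFReal, NNReal.coe_one, mul_one, sub_zero]
  rw [show -(1 / 2) * x ^ 2 = -x ^ 2 / 2 by ring]
  ring

/-- Gaussian integration by parts on the line. -/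
lemma integral_mul_gaussianReal {f f' : ℝ → ℝ} {C C' : ℝ} (hf : ∀ x, HasDerivAt f (f' x) x)
    (hC : ∀ x, |f x| ≤ C) (hC' : ∀ x, |f' x| ≤ C') :
    ∫ x, x * f x ∂gaussianReal 0 1 = ∫ x, f' x ∂gaussianReal 0 1 := by
  have hfc : Continuous f := continuous_iff_continuousAt.2 fun x => (hf x).continuousAt
  have hf'm : Measurable f' := by
    rw [show f' = deriv f from funext fun x => (hf x).deriv.symm]
    exact measurable_deriv f
  rw [integral_gaussianReal_eq_integral_smul one_ne_zero,
    integral_gaussianReal_eq_integral_smul one_ne_zero]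
  have h := integral_mul_deriv_eq_deriv_mul_of_integrable
    (u := f) (u' := f') (v := gaussianPDFReal 0 1) (v' := fun x => -(x * gaussianPDFReal 0 1 x))
    (fun x _ => hf x) (fun x _ => hasDerivAt_gaussianPDFReal x)
    (integrable_mul_gaussianPDFReal.neg.bdd_mul hfc.aestronglyMeasurable (ae_of_all _ hC))
    ((integrable_gaussianPDFReal 0 1).bdd_mul hf'm.aestronglyMeasurable (ae_of_all _ hC'))
    ((integrable_gaussianPDFReal 0 1).bdd_mul hfc.aestronglyMeasurable (ae_of_all _ hC))
  simp only [smul_eq_mul]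
  calc ∫ x, gaussianPDFReal 0 1 x * (x * f x)
      = -∫ x, f x * -(x * gaussianPDFReal 0 1 x) := by
        rw [← integral_neg]; congr 1; ext x; ring
    _ = ∫ x, gaussianPDFReal 0 1 x * f' x := by
        rw [h, neg_neg]; congr 1; ext x; ring

variable {ι : Type*} [Fintype ι] [DecidableEq ι]

/-- Replacing one coordinate by an independent copy does not change a product law; this isolates a
single Gaussian entry while the others stay frozen. -/
lemma measurePreserving_update {α : ι → Type*} [∀ i, MeasurableSpace (α i)]
    (μ : ∀ i, Measure (α i)) [∀ i, IsProbabilityMeasure (μ i)] (i : ι) :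
    MeasurePreserving (fun p : (∀ j, α j) × α i => Function.update p.1 i p.2)
      ((Measure.pi μ).prod (μ i)) (Measure.pi μ) := by
  have hm : Measurable fun p : (∀ j, α j) × α i => Function.update p.1 i p.2 := by
    refine measurable_pi_lambda _ fun j => ?_
    by_cases h : j = i
    · subst h; simpa using measurable_snd
    · simp only [Function.update_of_ne h]
      exact (measurable_pi_apply j).comp measurable_fst
  refine ⟨hm, (Measure.pi_eq fun s hs => ?_).symm⟩
  rw [Measure.map_apply hm (MeasurableSet.univ_pi hs)]
  have h : (fun p : (∀ j, α j) × α i => Function.update p.1 i p.2) ⁻¹' Set.univ.pi s =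
      (Set.univ.pi (Function.update s i Set.univ)) ×ˢ s i := by
    ext p
    simp only [Set.mem_preimage, Set.mem_pi, Set.mem_univ, true_implies, Set.mem_prod]
    constructor
    · intro hp
      refine ⟨fun j => ?_, by simpa using hp i⟩
      by_cases h : j = i
      · subst h; simp
      · simpa [Function.update_of_ne h] using hp j
    · rintro ⟨h1, h2⟩ j
      by_cases h : j = i
      · subst h; simpa using h2
      · simpa [Function.update_of_ne h] using h1 j
  rw [h, Measure.prod_prod, Measure.pi_pi, ← Finset.mul_prod_erase _ _ (Finset.mem_univ i),
    ← Finset.mul_prod_erase (a := i) Finset.univ (fun j => μ j (s j)) (Finset.mem_univ i), mul_comm]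
  simp only [Function.update_self, measure_univ, one_mul]
  congr 1
  refine Finset.prod_congr rfl fun j hj => ?_
  rw [Function.update_of_ne (Finset.ne_of_mem_erase hj)]

lemma integral_pi_update {α : ι → Type*} [∀ i, MeasurableSpace (α i)]
    (μ : ∀ i, Measure (α i)) [∀ i, IsProbabilityMeasure (μ i)] (i : ι) {g : (∀ j, α j) → ℝ}
    (hg : Integrable g (Measure.pi μ)) :
    ∫ x, g x ∂Measure.pi μ =
      ∫ x, ∫ y, g (Function.update x i y) ∂μ i ∂Measure.pi μ := by
  have h := measurePreserving_update μ i
  have hi : Integrable (fun p : (∀ j, α j) × α i => g (Function.update p.1 i p.2))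
      ((Measure.pi μ).prod (μ i)) := h.integrable_comp_of_integrable hg
  rw [← integral_prod _ hi]
  have hg' : AEStronglyMeasurable g (Measure.map
      (fun p : (∀ j, α j) × α i => Function.update p.1 i p.2) ((Measure.pi μ).prod (μ i))) := by
    rw [h.map_eq]; exact hg.1
  rw [← integral_map h.measurable.aemeasurable hg', h.map_eq]

/-- The law of a matrix, given by its columns, with independent standard Gaussian entries. -/
noncomputable def gaussianColumns (ι κ : Type*) [Fintype ι] [Fintype κ] :
    Measure (κ → ι → ℝ) :=
  Measure.pi fun _ => Measure.pi fun _ => gaussianReal 0 1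

instance (ι κ : Type*) [Fintype ι] [Fintype κ] : IsProbabilityMeasure (gaussianColumns ι κ) := by
  unfold gaussianColumns; infer_instance

variable {κ : Type*} [Fintype κ] [DecidableEq κ]

omit [DecidableEq ι] [DecidableEq κ] in
lemma integrable_eval_gaussianColumns (i : ι) (k : κ) :
    Integrable (fun X => X k i) (gaussianColumns ι κ) := by
  have h0 : Integrable (fun x : ℝ => x) (gaussianReal 0 1) :=
    memLp_one_iff_integrable.1 (memLp_id_gaussianReal 1)
  have h1 : MeasurePreserving (fun x : ι → ℝ => x i) (Measure.pi fun _ => gaussianReal 0 1)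
    (gaussianReal 0 1) := measurePreserving_eval (fun _ : ι => gaussianReal 0 1) i
  have h2 : MeasurePreserving (fun X : κ → ι → ℝ => X k) (gaussianColumns ι κ)
    (Measure.pi fun _ => gaussianReal 0 1) :=
    measurePreserving_eval (fun _ : κ => Measure.pi fun _ : ι => gaussianReal 0 1) k
  exact (h1.comp h2).integrable_comp_of_integrable h0

/-- Gaussian integration by parts in one entry of a standard Gaussian matrix. -/
lemma integral_mul_gaussianColumns (i : ι) (k : κ) {f f' : (κ → ι → ℝ) → ℝ} {C C' : ℝ}
    (hfm : Measurable f) (hfm' : Measurable f')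
    (hf : ∀ X t, HasDerivAt (fun s => f (Function.update X k (Function.update (X k) i s)))
      (f' (Function.update X k (Function.update (X k) i t))) t)
    (hC : ∀ X, |f X| ≤ C) (hC' : ∀ X, |f' X| ≤ C') :
    ∫ X, X k i * f X ∂gaussianColumns ι κ = ∫ X, f' X ∂gaussianColumns ι κ := by
  have hi : Integrable (fun X => X k i * f X) (gaussianColumns ι κ) :=
    (integrable_eval_gaussianColumns i k).mul_bdd hfm.aestronglyMeasurable (ae_of_all _ hC)
  have hi' : Integrable f' (gaussianColumns ι κ) :=
    Integrable.of_bound hfm'.aestronglyMeasurable C' (ae_of_all _ hC')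
  have hup : ∀ X : κ → ι → ℝ, Measurable fun y : ι → ℝ => Function.update X k y :=
    fun X => measurable_update X
  have hii : ∀ X : κ → ι → ℝ, Integrable
      (fun y : ι → ℝ => y i * f (Function.update X k y))
      (Measure.pi fun _ => gaussianReal 0 1) := fun X => by
    refine Integrable.mul_bdd (c := C) ?_ (hfm.comp (hup X)).aestronglyMeasurable
      (ae_of_all _ fun y => hC _)
    exact integrable_eval (memLp_one_iff_integrable.1 (memLp_id_gaussianReal 1))
  have hii' : ∀ X : κ → ι → ℝ, Integrable (fun y : ι → ℝ => f' (Function.update X k y))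
      (Measure.pi fun _ => gaussianReal 0 1) := fun X =>
    Integrable.of_bound (hfm'.comp (hup X)).aestronglyMeasurable C' (ae_of_all _ fun y => hC' _)
  unfold gaussianColumns at hi hi' ⊢
  -- Two resamplings are needed because the law is a nested product: first column `k`, then entry
  -- `i` within it.
  rw [integral_pi_update _ k hi, integral_pi_update _ k hi']
  congr 1
  ext X
  simp only [Function.update_self]
  rw [integral_pi_update _ i (hii X), integral_pi_update _ i (hii' X)]
  congr 1
  ext y
  simp only [Function.update_self]
  refine integral_mul_gaussianReal (C := C) (C' := C') (fun t => ?_) (fun t => hC _) fun t => hC' _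
  simpa using hf (Function.update X k y) t

end Stein

/-! ### Measurability of matrix operations. -/

section Measurability

variable {Ω ι κ τ : Type*} [MeasurableSpace Ω] [Fintype ι] [DecidableEq ι] [Fintype κ]

omit [Fintype ι] [DecidableEq ι] in
lemma measurable_matrix_mul {M : Ω → Matrix ι κ ℝ} {N : Ω → Matrix κ τ ℝ}
    (hM : ∀ i j, Measurable fun ω => M ω i j) (hN : ∀ i j, Measurable fun ω => N ω i j)
    (i : ι) (j : τ) : Measurable fun ω => (M ω * N ω) i j := by
  simp only [mul_apply]
  exact Finset.measurable_sum _ fun k _ => (hM i k).mul (hN k j)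

lemma measurable_matrix_det {M : Ω → Matrix ι ι ℝ} (hM : ∀ i j, Measurable fun ω => M ω i j) :
    Measurable fun ω => (M ω).det := by
  simp only [det_apply]
  exact Finset.measurable_sum _ fun σ _ =>
    (Finset.measurable_prod _ fun i _ => hM _ _).const_smul _

/-- The inverse is `det⁻¹` times the adjugate, also at singular matrices, where `0⁻¹ = 0`. -/
lemma measurable_matrix_inv {M : Ω → Matrix ι ι ℝ} (hM : ∀ i j, Measurable fun ω => M ω i j)
    (i j : ι) : Measurable fun ω => (M ω)⁻¹ i j := by
  simp only [inv_def, Ring.inverse_eq_inv', Matrix.smul_apply, adjugate_apply, smul_eq_mul]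
  refine (measurable_matrix_det hM).inv.mul (measurable_matrix_det fun a b => ?_)
  by_cases h : a = j
  · subst h; simp
  · simpa [updateRow_ne h] using hM a b

lemma measurable_ridgeInv {A : Ω → Matrix ι κ ℝ} (hA : ∀ i j, Measurable fun ω => A ω i j)
    (ε : ℝ) (i j : ι) : Measurable fun ω => ridgeInv ε (A ω) i j := by
  refine measurable_matrix_inv (fun a b => ?_) i j
  exact (measurable_matrix_mul hA (fun a b => hA b a) a b).add_const _

omit [DecidableEq ι] in
lemma measurable_matrix_trace {M : Ω → Matrix ι ι ℝ}
    (hM : ∀ i j, Measurable fun ω => M ω i j) : Measurable fun ω => (M ω).trace :=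
  Finset.measurable_sum _ fun i _ => hM i i

end Measurability

/-! ### Almost sure invertibility and the expected inverse trace. -/

section InverseGram

open Filter Topology

variable {ι κ : Type*} [Fintype ι] [Fintype κ] [DecidableEq ι] [DecidableEq κ]

/-- The integrated divergence inequality for `(A Aᵗ + ε)⁻¹ A`. -/
lemma lintegral_ridgeInv_le (hcard : Fintype.card ι + 2 ≤ Fintype.card κ) {ε : ℝ} (hε : 0 < ε) :
    ∫⁻ X : κ → ι → ℝ, ENNReal.ofReal
      ((Fintype.card κ - Fintype.card ι - 1) * (ridgeInv ε (of X)ᵀ).trace +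
        ε * (ridgeInv ε (of X)ᵀ * (ridgeInv ε (of X)ᵀ)ᵀ).trace) ∂gaussianColumns ι κ ≤
      ENNReal.ofReal (Fintype.card ι) := by
  have hAm : ∀ i k, Measurable fun X : κ → ι → ℝ => (of X)ᵀ i k := fun i k =>
    (measurable_pi_apply i).comp (measurable_pi_apply k)
  have hBm := measurable_ridgeInv hAm ε
  have hBAm := measurable_matrix_mul hBm hAm
  have hDm : ∀ i k, Measurable fun X : κ → ι → ℝ => ridgeDeriv ε (of X)ᵀ i k := fun i k =>
    ((hBm i i).sub ((hBm i i).mul (measurable_matrix_mul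
      (measurable_matrix_mul (fun a b => hAm b a) hBm) hAm k k))).sub ((hBAm i k).pow_const 2)
  have hDi : ∀ i k, Integrable (fun X : κ → ι → ℝ => ridgeDeriv ε (of X)ᵀ i k)
      (gaussianColumns ι κ) := fun i k =>
    Integrable.of_bound (hDm i k).aestronglyMeasurable _
      (ae_of_all _ fun X => abs_ridgeDeriv_le hε _ i k)
  have hBAb : ∀ i k (X : κ → ι → ℝ), |(ridgeInv ε (of X)ᵀ * (of X)ᵀ) i k| ≤
      Real.sqrt (Fintype.card ι / ε) := fun i k X =>
    Real.abs_le_sqrt (sq_ridgeInv_mul_le hε _ i k)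
  have hAi : ∀ i k, Integrable (fun X : κ → ι → ℝ => X k i * (ridgeInv ε (of X)ᵀ * (of X)ᵀ) i k)
      (gaussianColumns ι κ) := fun i k =>
    (integrable_eval_gaussianColumns i k).mul_bdd (hBAm i k).aestronglyMeasurable
      (ae_of_all _ (hBAb i k))
  have hstein : ∀ i k, ∫ X : κ → ι → ℝ, X k i * (ridgeInv ε (of X)ᵀ * (of X)ᵀ) i k
      ∂gaussianColumns ι κ = ∫ X, ridgeDeriv ε (of X)ᵀ i k ∂gaussianColumns ι κ := by
    intro i k
    refine integral_mul_gaussianColumns i k (hBAm i k) (hDm i k) (fun X t => ?_) (hBAb i k)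
      fun X => abs_ridgeDeriv_le hε _ i k
    refine hasDerivAt_ridgeInv_mul hε
      (c := fun s => (of (Function.update X k (Function.update (X k) i s)))ᵀ) fun a b => ?_
    by_cases hb : b = k
    · subst hb
      by_cases ha : a = i
      · subst ha
        simpa using hasDerivAt_id' t
      · simpa [ha, Ne.symm ha, Matrix.single] using hasDerivAt_const t (X b a)
    · simpa [hb, Ne.symm hb, Matrix.single] using hasDerivAt_const t (X b a)
  have hpt : ∀ X : κ → ι → ℝ, ∑ k, ∑ i, X k i * (ridgeInv ε (of X)ᵀ * (of X)ᵀ) i k =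
      ((of X)ᵀᵀ * ridgeInv ε (of X)ᵀ * (of X)ᵀ).trace := by
    intro X
    simp only [trace, Matrix.mul_assoc, diag_apply]
    exact Finset.sum_congr rfl fun k _ => by rw [mul_apply]; rfl
  -- Integration by parts read backwards: the integrated divergence is the integral of `tr(Aᵗ B A) =
  -- n - ε tr B ≤ n`.
  have hkey : ∫ X : κ → ι → ℝ, ∑ k, ∑ i, ridgeDeriv ε (of X)ᵀ i k ∂gaussianColumns ι κ ≤
      Fintype.card ι := by
    rw [integral_finsetSum _ fun k _ => integrable_finsetSum _ fun i _ => hDi i k]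
    simp only [integral_finsetSum _ fun i _ => hDi i _, ← hstein]
    simp only [← integral_finsetSum _ fun i _ => hAi i _]
    rw [← integral_finsetSum _ fun k _ => integrable_finsetSum _ fun i _ => hAi i k]
    calc _ ≤ ∫ X : κ → ι → ℝ, (Fintype.card ι : ℝ) ∂gaussianColumns ι κ := by
          refine integral_mono
            (integrable_finsetSum _ fun k _ => integrable_finsetSum _ fun i _ => hAi i k)
            (integrable_const _) fun X => ?_
          change ∑ k, ∑ i, X k i * (ridgeInv ε (of X)ᵀ * (of X)ᵀ) i k ≤ _
          rw [hpt, trace_transpose_ridgeInv_mul hε]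
          have := mul_nonneg hε.le (trace_ridgeInv_nonneg hε (of X)ᵀ)
          linarith
      _ = _ := by simp
  -- Only `ε (tr B)²` is discarded; `ε tr(B Bᵗ)` is kept to detect singular Gram matrices.
  have hle : ∀ X : κ → ι → ℝ,
      (Fintype.card κ - Fintype.card ι - 1) * (ridgeInv ε (of X)ᵀ).trace +
        ε * (ridgeInv ε (of X)ᵀ * (ridgeInv ε (of X)ᵀ)ᵀ).trace ≤
      ∑ k, ∑ i, ridgeDeriv ε (of X)ᵀ i k := by
    intro X
    rw [sum_ridgeDeriv hε]
    have := mul_nonneg hε.le (sq_nonneg (ridgeInv ε (of X)ᵀ).trace)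
    linarith
  have hnn : ∀ X : κ → ι → ℝ, 0 ≤ ∑ k, ∑ i, ridgeDeriv ε (of X)ᵀ i k := by
    intro X
    refine le_trans ?_ (hle X)
    have h1 : (Fintype.card ι : ℝ) + 2 ≤ Fintype.card κ := by exact_mod_cast hcard
    have h2 : 0 ≤ (ridgeInv ε (of X)ᵀ * (ridgeInv ε (of X)ᵀ)ᵀ).trace := by
      rw [trace_mul_transpose_self]
      positivity
    have h3 := mul_nonneg (show (0 : ℝ) ≤ Fintype.card κ - Fintype.card ι - 1 by linarith)
      (trace_ridgeInv_nonneg hε (of X)ᵀ)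
    have h4 := mul_nonneg hε.le h2
    linarith
  calc _ ≤ ∫⁻ X : κ → ι → ℝ, ENNReal.ofReal (∑ k, ∑ i, ridgeDeriv ε (of X)ᵀ i k)
        ∂gaussianColumns ι κ := lintegral_mono fun X => ENNReal.ofReal_le_ofReal (hle X)
    _ = ENNReal.ofReal (∫ X : κ → ι → ℝ, ∑ k, ∑ i, ridgeDeriv ε (of X)ᵀ i k
        ∂gaussianColumns ι κ) := by
        rw [ofReal_integral_eq_lintegral_ofReal
          (integrable_finsetSum _ fun k _ => integrable_finsetSum _ fun i _ => hDi i k)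
          (ae_of_all _ hnn)]
    _ ≤ _ := ENNReal.ofReal_le_ofReal hkey

-- A kernel vector of `A Aᵗ` is an eigenvector of the regularised inverse for `ε⁻¹`, and row-by-row
-- Cauchy-Schwarz bounds the squared Frobenius norm below by `ε⁻²`.
omit [DecidableEq κ] in
lemma inv_sq_le_trace_ridgeInv_mul_transpose {ε : ℝ} (hε : 0 < ε) {A : Matrix ι κ ℝ}
    (hA : ¬ IsUnit (A * Aᵀ)) :
    ε⁻¹ ^ 2 ≤ (ridgeInv ε A * (ridgeInv ε A)ᵀ).trace := by
  rw [isUnit_iff_isUnit_det, isUnit_iff_ne_zero, not_not] at hA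
  obtain ⟨v, hv0, hv⟩ := exists_mulVec_eq_zero_iff.2 hA
  have h1 : ridgeInv ε A *ᵥ v = ε⁻¹ • v := by
    have h : ridgeInv ε A * (A * Aᵀ + ε • (1 : Matrix ι ι ℝ)) = 1 :=
      nonsing_inv_mul _ ((isUnit_iff_isUnit_det _).1 (posDef_gram_add hε A).isUnit)
    have h2 := congrArg (· *ᵥ v) h
    simp only [← mulVec_mulVec, add_mulVec, hv, zero_add, smul_mulVec, one_mulVec,
      mulVec_smul] at h2
    rw [← h2, smul_smul, inv_mul_cancel₀ hε.ne', one_smul, h2]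
  have h2 : 0 < ∑ j, v j ^ 2 := by
    obtain ⟨j, hj⟩ := Function.ne_iff.1 hv0
    exact Finset.sum_pos' (fun _ _ => sq_nonneg _) ⟨j, Finset.mem_univ j, by
      have : v j ≠ 0 := hj
      positivity⟩
  rw [trace_mul_transpose_self]
  refine le_of_mul_le_mul_right ?_ h2
  rw [Finset.mul_sum, Finset.sum_mul]
  refine Finset.sum_le_sum fun i _ => ?_
  have h3 : ε⁻¹ ^ 2 * v i ^ 2 = (∑ j, ridgeInv ε A i j * v j) ^ 2 := by
    have := congrFun h1 i
    simp only [mulVec, dotProduct, Pi.smul_apply, smul_eq_mul] at this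
    rw [this]; ring
  rw [h3]
  exact Finset.sum_mul_sq_le_sq_mul_sq _ _ _

omit [DecidableEq κ] in
lemma tendsto_trace_ridgeInv {A : Matrix ι κ ℝ} (hA : IsUnit (A * Aᵀ)) :
    Tendsto (fun ε => (ridgeInv ε A).trace) (𝓝 0) (𝓝 (A * Aᵀ)⁻¹.trace) := by
  refine tendsto_finsetSum _ fun i _ => ?_
  have hM : ∀ a b, HasDerivAt (fun ε : ℝ => (A * Aᵀ + ε • (1 : Matrix ι ι ℝ)) a b)
      ((1 : Matrix ι ι ℝ) a b) 0 := fun a b => by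
    simpa using ((hasDerivAt_id (0 : ℝ)).mul_const ((1 : Matrix ι ι ℝ) a b)).const_add
      ((A * Aᵀ) a b)
  have h := (hasDerivAt_matrix_inv hM (by simpa using hA) i i).continuousAt.tendsto
  simpa [ridgeInv] using h

/-- Fatou along `ε = 1 / (j + 1)`, the bound being uniform in `ε`. -/
lemma lintegral_liminf_ridgeInv_le (hcard : Fintype.card ι + 2 ≤ Fintype.card κ) :
    ∫⁻ X : κ → ι → ℝ, liminf (fun j : ℕ => ENNReal.ofReal
      ((Fintype.card κ - Fintype.card ι - 1) * (ridgeInv (1 / (j + 1 : ℝ)) (of X)ᵀ).trace +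
        1 / (j + 1 : ℝ) * (ridgeInv (1 / (j + 1 : ℝ)) (of X)ᵀ *
          (ridgeInv (1 / (j + 1 : ℝ)) (of X)ᵀ)ᵀ).trace)) atTop ∂gaussianColumns ι κ ≤
      ENNReal.ofReal (Fintype.card ι) := by
  have hAm : ∀ i k, Measurable fun X : κ → ι → ℝ => (of X)ᵀ i k := fun i k =>
    (measurable_pi_apply i).comp (measurable_pi_apply k)
  refine (lintegral_liminf_le fun j => ?_).trans ?_
  · have hB := measurable_ridgeInv hAm (1 / (j + 1 : ℝ))
    exact (((measurable_matrix_trace hB).const_mul _).add ((measurable_matrix_trace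
      (measurable_matrix_mul hB fun a b => hB b a)).const_mul _)).ennreal_ofReal
  · exact liminf_le_of_le (by isBoundedDefault) fun b hb => by
      obtain ⟨j, hj⟩ := hb.exists
      exact hj.trans (lintegral_ridgeInv_le hcard Nat.one_div_pos_of_nat)

/-- A standard Gaussian matrix with at least two more columns than rows has full rank. -/
lemma ae_isUnit_gram (hcard : Fintype.card ι + 2 ≤ Fintype.card κ) :
    ∀ᵐ X : κ → ι → ℝ ∂gaussianColumns ι κ, IsUnit ((of X)ᵀ * (of X)ᵀᵀ) := by
  have hAm : ∀ i k, Measurable fun X : κ → ι → ℝ => (of X)ᵀ i k := fun i k =>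
    (measurable_pi_apply i).comp (measurable_pi_apply k)
  have h1 : (1 : ℝ) ≤ Fintype.card κ - Fintype.card ι - 1 := by
    have : (Fintype.card ι : ℝ) + 2 ≤ Fintype.card κ := by exact_mod_cast hcard
    linarith
  have h := ae_lt_top (Measurable.liminf fun j : ℕ => ?_)
    ((lintegral_liminf_ridgeInv_le (ι := ι) (κ := κ) hcard).trans_lt ENNReal.ofReal_lt_top).ne
  · filter_upwards [h] with X hX
    -- At a singular point the integrand is at least `ε * ε⁻² = j + 1`, so its liminf is infinite,
    -- contradicting almost everywhere finiteness.
    by_contra hA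
    refine hX.ne (Tendsto.liminf_eq ?_)
    refine tendsto_nhds_top_mono' ENNReal.tendsto_nat_nhds_top fun j => ?_
    have hε : (0 : ℝ) < 1 / (j + 1 : ℝ) := Nat.one_div_pos_of_nat
    have h2 := mul_le_mul_of_nonneg_left (inv_sq_le_trace_ridgeInv_mul_transpose hε hA) hε.le
    have h3 := mul_nonneg (zero_le_one.trans h1) (trace_ridgeInv_nonneg hε (of X)ᵀ)
    have h4 : 1 / (j + 1 : ℝ) * (1 / (j + 1 : ℝ))⁻¹ ^ 2 = j + 1 := by field_simp
    rw [← ENNReal.ofReal_natCast]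
    refine ENNReal.ofReal_le_ofReal ?_
    linarith
  · have hB := measurable_ridgeInv hAm (1 / (j + 1 : ℝ))
    exact (((measurable_matrix_trace hB).const_mul _).add ((measurable_matrix_trace
      (measurable_matrix_mul hB fun a b => hB b a)).const_mul _)).ennreal_ofReal

/-- The expected trace of the inverse of a standard Wishart matrix. -/
lemma lintegral_trace_inv_gram_le (hcard : Fintype.card ι + 2 ≤ Fintype.card κ) :
    ∫⁻ X : κ → ι → ℝ, ENNReal.ofReal ((of X)ᵀ * (of X)ᵀᵀ)⁻¹.trace ∂gaussianColumns ι κ ≤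
      ENNReal.ofReal (Fintype.card ι / (Fintype.card κ - Fintype.card ι - 1)) := by
  have h1 : (0 : ℝ) < Fintype.card κ - Fintype.card ι - 1 := by
    have : (Fintype.card ι : ℝ) + 2 ≤ Fintype.card κ := by exact_mod_cast hcard
    linarith
  have h2 : ∫⁻ X : κ → ι → ℝ, ENNReal.ofReal ((Fintype.card κ - Fintype.card ι - 1) *
      ((of X)ᵀ * (of X)ᵀᵀ)⁻¹.trace) ∂gaussianColumns ι κ ≤ ENNReal.ofReal (Fintype.card ι) := by
    refine (lintegral_mono_ae ?_).trans (lintegral_liminf_ridgeInv_le hcard)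
    filter_upwards [ae_isUnit_gram hcard] with X hX
    -- At invertible points the main term converges, so its liminf is the limit; the remaining `ε`
    -- term is nonnegative and can be dropped.
    have h := ((ENNReal.continuous_ofReal.tendsto _).comp
      (((tendsto_trace_ridgeInv hX).comp tendsto_one_div_add_atTop_nhds_zero_nat).const_mul
        ((Fintype.card κ : ℝ) - Fintype.card ι - 1))).liminf_eq
    rw [← h]
    refine liminf_le_liminf (Eventually.of_forall fun j => ENNReal.ofReal_le_ofReal ?_)
    have hε : (0 : ℝ) < 1 / (j + 1 : ℝ) := Nat.one_div_pos_of_nat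
    have h3 : 0 ≤ (ridgeInv (1 / (j + 1 : ℝ)) (of X)ᵀ *
        (ridgeInv (1 / (j + 1 : ℝ)) (of X)ᵀ)ᵀ).trace := by
      rw [trace_mul_transpose_self]
      positivity
    have h4 := mul_nonneg hε.le h3
    simp only [Function.comp_apply]
    linarith
  simp only [ENNReal.ofReal_mul h1.le] at h2
  rw [lintegral_const_mul' _ _ ENNReal.ofReal_ne_top] at h2
  rw [ENNReal.ofReal_div_of_pos h1]
  refine (ENNReal.le_div_iff_mul_le (Or.inl ?_) (Or.inl ENNReal.ofReal_ne_top)).2 ?_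
  · exact (ENNReal.ofReal_pos.2 h1).ne'
  · rwa [mul_comm]

end InverseGram

/-! ### Rotation invariance of the Gaussian matrix. -/

section OrthogonalInvariance

variable {ι κ : Type*} [Fintype ι] [Fintype κ] [DecidableEq ι]

/-- An orthogonal matrix, as a linear isometry of Euclidean space. -/
noncomputable def orthogonalIsometry {Q : Matrix ι ι ℝ} (hQ : Qᵀ * Q = 1) :
    EuclideanSpace ℝ ι ≃ₗᵢ[ℝ] EuclideanSpace ℝ ι :=
  LinearIsometry.toLinearIsometryEquiv
    { Matrix.toLpLin 2 2 Q with
      norm_map' := fun x => by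
        have h : (Q *ᵥ x.ofLp) ⬝ᵥ (Q *ᵥ x.ofLp) = x.ofLp ⬝ᵥ x.ofLp := by
          rw [dotProduct_mulVec, vecMul_mulVec, hQ, vecMul_one]
        rw [EuclideanSpace.norm_eq, EuclideanSpace.norm_eq]
        congr 1
        simpa [dotProduct, sq] using h } rfl

lemma measurePreserving_mulVec_pi_gaussianReal {Q : Matrix ι ι ℝ} (hQ : Qᵀ * Q = 1) :
    MeasurePreserving (fun x : ι → ℝ => Q *ᵥ x) (Measure.pi fun _ => gaussianReal 0 1)
      (Measure.pi fun _ => gaussianReal 0 1) := by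
  have h1 : MeasurePreserving (WithLp.toLp 2) (Measure.pi fun _ : ι => gaussianReal 0 1)
      (stdGaussian (EuclideanSpace ℝ ι)) := ⟨by fun_prop, map_pi_eq_stdGaussian⟩
  have h2 : MeasurePreserving (orthogonalIsometry hQ) (stdGaussian (EuclideanSpace ℝ ι))
      (stdGaussian (EuclideanSpace ℝ ι)) :=
    ⟨(orthogonalIsometry hQ).continuous.measurable, stdGaussian_map _⟩
  have h3 : MeasurePreserving (MeasurableEquiv.toLp 2 (ι → ℝ)).symm
      (stdGaussian (EuclideanSpace ℝ ι)) (Measure.pi fun _ : ι => gaussianReal 0 1) :=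
    MeasurePreserving.symm (MeasurableEquiv.toLp 2 (ι → ℝ)) h1
  exact h3.comp (h2.comp h1)

lemma measurePreserving_mulVec_gaussianColumns {Q : Matrix ι ι ℝ} (hQ : Qᵀ * Q = 1) :
    MeasurePreserving (fun (X : κ → ι → ℝ) k => Q *ᵥ X k) (gaussianColumns ι κ)
      (gaussianColumns ι κ) :=
  measurePreserving_pi _ _ fun _ => measurePreserving_mulVec_pi_gaussianReal hQ

lemma inv_gram_orthogonal_mul {Q : Matrix ι ι ℝ} (hQ : Qᵀ * Q = 1) (A : Matrix ι κ ℝ) :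
    ((Q * A) * (Q * A)ᵀ)⁻¹ = Q * (A * Aᵀ)⁻¹ * Qᵀ := by
  have hQ' : Q * Qᵀ = 1 := mul_eq_one_comm.1 hQ
  have h1 : (Q * A) * (Q * A)ᵀ = Q * (A * Aᵀ) * Qᵀ := by
    simp only [transpose_mul, Matrix.mul_assoc]
  rw [h1, Matrix.mul_inv_rev, Matrix.mul_inv_rev, inv_eq_left_inv hQ, inv_eq_left_inv hQ', Matrix.mul_assoc]

lemma posSemidef_inv_gram (A : Matrix ι κ ℝ) : (A * Aᵀ)⁻¹.PosSemidef := by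
  have h := posSemidef_self_mul_conjTranspose A
  rw [conjTranspose_eq_transpose_of_trivial] at h
  exact h.inv

end OrthogonalInvariance

/-! ### Averaging over cyclic orders of the eigenvalues. -/

section Averaging

variable {κ : Type*} [Fintype κ] {n : ℕ} [NeZero n]

/-- Jensen for the concave power with weights `1 / n`: addition in `Fin n` is cyclic, so over all
shifts each pair `(i, j)` occurs exactly once and the double sum factors. -/
lemma sum_rpow_cyclic_le {p : ℝ} (hp0 : 0 ≤ p) (hp1 : p ≤ 1) {a b : Fin n → ℝ}
    (ha : ∀ i, 0 ≤ a i) (hb : ∀ i, 0 ≤ b i) :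
    ∑ c, (∑ i, a i * b (i + c)) ^ p ≤ n * (((∑ i, a i) * ∑ i, b i) / n) ^ p := by
  have hn : (0 : ℝ) < n := by exact_mod_cast Nat.pos_of_ne_zero (NeZero.ne n)
  have h := (Real.concaveOn_rpow hp0 hp1).le_map_sum (t := Finset.univ)
    (w := fun _ : Fin n => (n : ℝ)⁻¹) (p := fun c => ∑ i, a i * b (i + c))
    (fun _ _ => by positivity) (by simp [hn.ne'])
    (fun c _ => Finset.sum_nonneg fun i _ => mul_nonneg (ha i) (hb _))
  simp only [smul_eq_mul, ← Finset.mul_sum] at h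
  have h2 : ∑ c, ∑ i, a i * b (i + c) = (∑ i, a i) * ∑ i, b i := by
    rw [Finset.sum_comm, Finset.sum_mul]
    refine Finset.sum_congr rfl fun i _ => ?_
    rw [← Finset.mul_sum, ← Equiv.sum_comp (Equiv.addLeft i) b]
    rfl
  rw [h2, inv_mul_le_iff₀ hn] at h
  rwa [div_eq_inv_mul]

/-- For a standard Gaussian matrix `A`, `E[tr((A Aᵗ)⁻¹ S)ᵖ]` is maximal, among the positive
semidefinite `S` of given trace, at multiples of the identity. -/
lemma lintegral_trace_inv_gram_mul_rpow_le {p : ℝ} (hp0 : 0 ≤ p) (hp1 : p ≤ 1)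
    {S : Matrix (Fin n) (Fin n) ℝ} (hS : S.PosSemidef) :
    ∫⁻ X : κ → Fin n → ℝ, ENNReal.ofReal ((((of X)ᵀ * (of X)ᵀᵀ)⁻¹ * S).trace ^ p)
        ∂gaussianColumns (Fin n) κ ≤
      ENNReal.ofReal ((S.trace / n) ^ p) *
        ∫⁻ X : κ → Fin n → ℝ, ENNReal.ofReal (((of X)ᵀ * (of X)ᵀᵀ)⁻¹.trace ^ p)
          ∂gaussianColumns (Fin n) κ := by
  have hn : (0 : ℝ) < n := by exact_mod_cast Nat.pos_of_ne_zero (NeZero.ne n)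
  have hAm : ∀ i k, Measurable fun X : κ → Fin n → ℝ => (of X)ᵀ i k := fun i k =>
    (measurable_pi_apply i).comp (measurable_pi_apply k)
  have hGm : ∀ i j, Measurable fun X : κ → Fin n → ℝ => ((of X)ᵀ * (of X)ᵀᵀ)⁻¹ i j :=
    measurable_matrix_inv (measurable_matrix_mul hAm fun a b => hAm b a)
  have hGSm : ∀ i j, Measurable fun X : κ → Fin n → ℝ => (((of X)ᵀ * (of X)ᵀᵀ)⁻¹ * S) i j :=
    measurable_matrix_mul hGm fun a b => measurable_const
  set E : Matrix (Fin n) (Fin n) ℝ := (hS.1.eigenvectorUnitary : Matrix (Fin n) (Fin n) ℝ) with hE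
  set d := hS.1.eigenvalues with hd
  have hEE : Eᵀ * E = 1 := by
    have := Unitary.coe_star_mul_self hS.1.eigenvectorUnitary
    rwa [star_eq_conjTranspose, conjTranspose_eq_transpose_of_trivial] at this
  have hES : Eᵀ * S * E = diagonal d := by
    have h := hS.1.spectral_theorem
    rw [Unitary.conjStarAlgAut_apply, star_eq_conjTranspose,
      conjTranspose_eq_transpose_of_trivial] at h
    rw [h, ← hE, Matrix.mul_assoc, Matrix.mul_assoc, hEE, Matrix.mul_one, ← Matrix.mul_assoc, hEE,
      Matrix.one_mul]
    rfl
  have htr : S.trace = ∑ i, d i := by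
    simpa using hS.1.trace_eq_sum_eigenvalues
  -- Permuting the columns of the eigenvector matrix leaves it orthogonal, so each shift `c` gives
  -- another expression for the same integral. Summing them permits Jensen pointwise in `X`, and the
  -- factor `n` cancels at the end.
  have hrot : ∀ c : Fin n,
      ∫⁻ X : κ → Fin n → ℝ, ENNReal.ofReal ((((of X)ᵀ * (of X)ᵀᵀ)⁻¹ * S).trace ^ p)
        ∂gaussianColumns (Fin n) κ =
      ∫⁻ X : κ → Fin n → ℝ, ENNReal.ofReal
        ((∑ i, ((of X)ᵀ * (of X)ᵀᵀ)⁻¹ i i * d (i + c)) ^ p) ∂gaussianColumns (Fin n) κ := by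
    intro c
    set Q := E.submatrix id (Equiv.addRight c) with hQ
    have hQQ : Qᵀ * Q = 1 := by
      change (Eᵀ * E).submatrix (Equiv.addRight c) (Equiv.addRight c) = 1
      rw [hEE, submatrix_one_equiv]
    have hQS : Qᵀ * S * Q = diagonal fun i => d (i + c) := by
      change (Eᵀ * S * E).submatrix (Equiv.addRight c) (Equiv.addRight c) = _
      rw [hES, submatrix_diagonal_equiv]
      rfl
    have hm : Measurable fun X : κ → Fin n → ℝ =>
        ENNReal.ofReal ((((of X)ᵀ * (of X)ᵀᵀ)⁻¹ * S).trace ^ p) :=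
      ((measurable_matrix_trace hGSm).pow_const p).ennreal_ofReal
    rw [← (measurePreserving_mulVec_gaussianColumns (κ := κ) hQQ).lintegral_comp hm]
    refine lintegral_congr fun X => ?_
    have h1 : (of fun k => Q *ᵥ X k)ᵀ = Q * (of X)ᵀ := by
      ext i k
      simp [mul_apply, mulVec, dotProduct]
    have h2 : ∀ G : Matrix (Fin n) (Fin n) ℝ, (Q * G * Qᵀ * S).trace =
        ∑ i, G i i * d (i + c) := fun G => by
      rw [Matrix.mul_assoc, Matrix.mul_assoc, trace_mul_comm, Matrix.mul_assoc, hQS]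
      simp [trace]
    rw [h1, inv_gram_orthogonal_mul hQQ, h2]
  have hsum : (n : ENNReal) * ∫⁻ X : κ → Fin n → ℝ,
      ENNReal.ofReal ((((of X)ᵀ * (of X)ᵀᵀ)⁻¹ * S).trace ^ p) ∂gaussianColumns (Fin n) κ ≤
      n * (ENNReal.ofReal ((S.trace / n) ^ p) *
        ∫⁻ X : κ → Fin n → ℝ, ENNReal.ofReal (((of X)ᵀ * (of X)ᵀᵀ)⁻¹.trace ^ p)
          ∂gaussianColumns (Fin n) κ) := by
    calc _ = ∑ c : Fin n, ∫⁻ X : κ → Fin n → ℝ,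
          ENNReal.ofReal ((((of X)ᵀ * (of X)ᵀᵀ)⁻¹ * S).trace ^ p) ∂gaussianColumns (Fin n) κ := by
          simp
      _ = ∑ c : Fin n, ∫⁻ X : κ → Fin n → ℝ, ENNReal.ofReal
            ((∑ i, ((of X)ᵀ * (of X)ᵀᵀ)⁻¹ i i * d (i + c)) ^ p) ∂gaussianColumns (Fin n) κ :=
          Finset.sum_congr rfl fun c _ => hrot c
      _ = ∫⁻ X : κ → Fin n → ℝ, ∑ c : Fin n, ENNReal.ofReal
            ((∑ i, ((of X)ᵀ * (of X)ᵀᵀ)⁻¹ i i * d (i + c)) ^ p) ∂gaussianColumns (Fin n) κ := by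
          rw [lintegral_finsetSum]
          exact fun c _ => ((Finset.measurable_sum _ fun i _ =>
            (hGm i i).mul_const _).pow_const p).ennreal_ofReal
      _ ≤ ∫⁻ X : κ → Fin n → ℝ, n * ENNReal.ofReal ((S.trace / n) ^ p) *
            ENNReal.ofReal (((of X)ᵀ * (of X)ᵀᵀ)⁻¹.trace ^ p) ∂gaussianColumns (Fin n) κ := by
          refine lintegral_mono fun X => ?_
          have hG := posSemidef_inv_gram (of X)ᵀ
          have hdn : ∀ i, 0 ≤ d i := hS.eigenvalues_nonneg
          have hSn : 0 ≤ S.trace / n := div_nonneg hS.trace_nonneg hn.le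
          rw [← ENNReal.ofReal_sum_of_nonneg fun c _ => Real.rpow_nonneg
              (Finset.sum_nonneg fun i _ => mul_nonneg hG.diag_nonneg (hdn _)) _,
            ← ENNReal.ofReal_natCast, ← ENNReal.ofReal_mul hn.le,
            ← ENNReal.ofReal_mul (by positivity), mul_assoc,
            ← Real.mul_rpow hSn hG.trace_nonneg]
          refine ENNReal.ofReal_le_ofReal
            ((sum_rpow_cyclic_le hp0 hp1 (fun i => hG.diag_nonneg) hdn).trans_eq ?_)
          rw [htr]
          congr 2
          simp only [trace, diag_apply]
          ring
      _ = _ := by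
          rw [lintegral_const_mul' _ _
            (ENNReal.mul_ne_top (ENNReal.natCast_ne_top n) ENNReal.ofReal_ne_top), mul_assoc]
  exact (ENNReal.mul_le_mul_iff_right (by exact_mod_cast NeZero.ne n)
    (ENNReal.natCast_ne_top n)).1 hsum

end Averaging

/-! ### The explicit solution and its conditional moments. -/

section Sylvester

variable {n m : ℕ}

lemma frobenius_norm_rpow {ι κ : Type*} [Fintype ι] [Fintype κ] (M : Matrix ι κ ℝ) (q : ℝ) :
    ‖M‖ ^ q = (M * Mᵀ).trace ^ (q / 2) := by
  have h0 : (0 : ℝ) ≤ ∑ i, ∑ j, M i j ^ 2 :=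
    Finset.sum_nonneg fun _ _ => Finset.sum_nonneg fun _ _ => sq_nonneg _
  have h1 : ‖M‖ = (∑ i, ∑ j, M i j ^ 2) ^ (1 / 2 : ℝ) := by
    rw [frobenius_norm_def]
    simp
  rw [trace_mul_transpose_self, h1, ← Real.rpow_mul h0]
  congr 1
  ring

lemma sylvesterMatrix_mul_transpose_trace (A : Matrix (Fin n) (Fin m) ℝ)
    (W : Matrix (Fin n) (Fin n) ℝ) :
    (sylvesterMatrix A W * (sylvesterMatrix A W)ᵀ).trace =
      1 / 4 * ((A * Aᵀ)⁻¹ * (W * Wᵀ)).trace := by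
  -- True for singular `A * Aᵀ` as well, whose `⁻¹` is `0`, so the trace formula holds at every
  -- point.
  have hG : (A * Aᵀ)⁻¹ * (A * Aᵀ) * (A * Aᵀ)⁻¹ = (A * Aᵀ)⁻¹ := by
    by_cases h : IsUnit (A * Aᵀ).det
    · rw [nonsing_inv_mul _ h, Matrix.one_mul]
    · rw [nonsing_inv_apply_not_isUnit _ h]; simp
  have hT : ((A * Aᵀ)⁻¹)ᵀ = (A * Aᵀ)⁻¹ := by
    rw [transpose_nonsing_inv, transpose_mul, transpose_transpose]
  have h1 : sylvesterMatrix A W * (sylvesterMatrix A W)ᵀ =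
      (1 / 4 : ℝ) • (Wᵀ * ((A * Aᵀ)⁻¹ * W)) := by
    conv_rhs => rw [← hG]
    simp only [sylvesterMatrix, transpose_smul, transpose_mul, transpose_transpose, hT,
      Matrix.smul_mul, Matrix.mul_smul, smul_smul, Matrix.mul_assoc]
    norm_num
  rw [h1, trace_smul, trace_mul_comm, Matrix.mul_assoc, smul_eq_mul]

/-- The matrix `𝒰` solves `𝒰 Aᵗ - A 𝒰ᵗ = W`. -/
lemma sylvesterMatrix_solves {A : Matrix (Fin n) (Fin m) ℝ} {W : Matrix (Fin n) (Fin n) ℝ}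
    (hA : IsUnit (A * Aᵀ)) (hW : Wᵀ = -W) :
    sylvesterMatrix A W * Aᵀ - A * (sylvesterMatrix A W)ᵀ = W := by
  have h1 : A * (sylvesterMatrix A W)ᵀ = -(1 / 2 : ℝ) • W := by
    rw [sylvesterMatrix, transpose_transpose, Matrix.mul_smul, ← Matrix.mul_assoc,
      ← Matrix.mul_assoc, mul_nonsing_inv _ ((isUnit_iff_isUnit_det _).1 hA), Matrix.one_mul]
  have h2 : sylvesterMatrix A W * Aᵀ = (1 / 2 : ℝ) • W := by
    have h := congrArg transpose h1
    rw [transpose_mul, transpose_transpose, transpose_smul, hW] at h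
    rw [h, smul_neg, neg_smul, neg_neg]
  rw [h1, h2, neg_smul, sub_neg_eq_add, ← add_smul]
  norm_num

lemma sum_odot (U V : Fin m → EuclideanSpace ℝ (Fin n)) :
    ∑ k, odot (U k) (V k) = colMatrix U * (colMatrix V)ᵀ - colMatrix V * (colMatrix U)ᵀ := by
  ext i j
  simp [odot, colMatrix, mul_apply, Matrix.sum_apply, vecMulVec_apply]

lemma measurable_sylvesterMatrix {Ω : Type*} [MeasurableSpace Ω]
    {A : Ω → Matrix (Fin n) (Fin m) ℝ} {W : Ω → Matrix (Fin n) (Fin n) ℝ}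
    (hA : ∀ i j, Measurable fun ω => A ω i j) (hW : ∀ i j, Measurable fun ω => W ω i j)
    (i : Fin n) (j : Fin m) : Measurable fun ω => sylvesterMatrix (A ω) (W ω) i j := by
  have hAT : ∀ i j, Measurable fun ω => (A ω)ᵀ i j := fun i j => hA j i
  exact (measurable_matrix_mul (measurable_matrix_mul hAT
    (measurable_matrix_inv (measurable_matrix_mul hA hAT))) hW j i).const_mul _

lemma measurable_frobenius_norm_rpow {Ω ι κ : Type*} [MeasurableSpace Ω] [Fintype ι] [Fintype κ]
    {M : Ω → Matrix ι κ ℝ} (hM : ∀ i j, Measurable fun ω => M ω i j) (q : ℝ) :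
    Measurable fun ω => ENNReal.ofReal (‖M ω‖ ^ q) := by
  simp only [frobenius_norm_rpow]
  exact ((measurable_matrix_trace (measurable_matrix_mul hM fun i j => hM j i)).pow_const
    _).ennreal_ofReal

/-- This is the bound for `W` frozen: averaging with `S = W Wᵗ` and `p = q / 2`. The constant
combines `(1/4)^(q/2) = 2^(-q)` with the `n^(-q/2)` from `tr S / n`. -/
lemma lintegral_sylvesterMatrix_le [NeZero n] {q : ℝ} (hq0 : 0 < q) (hq2 : q ≤ 2)
    (W : Matrix (Fin n) (Fin n) ℝ) :
    ∫⁻ X : Fin m → Fin n → ℝ, ENNReal.ofReal (‖sylvesterMatrix (of X)ᵀ W‖ ^ q)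
        ∂gaussianColumns (Fin n) (Fin m) ≤
      ENNReal.ofReal (1 / (2 ^ q * (n : ℝ) ^ (q / 2))) *
        (∫⁻ X : Fin m → Fin n → ℝ, ENNReal.ofReal (((of X)ᵀ * (of X)ᵀᵀ)⁻¹.trace ^ (q / 2))
          ∂gaussianColumns (Fin n) (Fin m)) * ENNReal.ofReal (‖W‖ ^ q) := by
  have hS : (W * Wᵀ).PosSemidef := by
    have h := posSemidef_self_mul_conjTranspose W
    rwa [conjTranspose_eq_transpose_of_trivial] at h
  have h4 : ((1 : ℝ) / 4) ^ (q / 2) = 1 / 2 ^ q := by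
    rw [show (1 : ℝ) / 4 = (1 / 2) ^ (2 : ℝ) by norm_num, ← Real.rpow_mul (by norm_num),
      mul_div_cancel₀ _ two_ne_zero, Real.div_rpow zero_le_one zero_le_two, Real.one_rpow]
  have h1 : ∀ X : Fin m → Fin n → ℝ, ‖sylvesterMatrix (of X)ᵀ W‖ ^ q =
      1 / 2 ^ q * (((of X)ᵀ * (of X)ᵀᵀ)⁻¹ * (W * Wᵀ)).trace ^ (q / 2) := by
    intro X
    have hnn : 0 ≤ (((of X)ᵀ * (of X)ᵀᵀ)⁻¹ * (W * Wᵀ)).trace := by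
      have h := (posSemidef_inv_gram (of X)ᵀ).conjTranspose_mul_mul_same W
      rw [conjTranspose_eq_transpose_of_trivial] at h
      rw [← Matrix.mul_assoc, trace_mul_comm, ← Matrix.mul_assoc]
      exact h.trace_nonneg
    rw [frobenius_norm_rpow, sylvesterMatrix_mul_transpose_trace,
      Real.mul_rpow (by norm_num) hnn, h4]
  have h2 : (0 : ℝ) ≤ 1 / 2 ^ q := by positivity
  simp only [h1, ENNReal.ofReal_mul h2]
  rw [lintegral_const_mul' _ _ ENNReal.ofReal_ne_top]
  refine (mul_le_mul_right (lintegral_trace_inv_gram_mul_rpow_le (κ := Fin m) (p := q / 2)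
    (by linarith) (by linarith) hS) _).trans_eq ?_
  rw [frobenius_norm_rpow, Real.div_rpow hS.trace_nonneg (Nat.cast_nonneg n), ← one_div_mul_one_div,
    ENNReal.ofReal_mul h2, div_eq_mul_one_div (_ ^ (q / 2)), ENNReal.ofReal_mul
      (Real.rpow_nonneg hS.trace_nonneg _)]
  ring

end Sylvester

/-! ### Transfer to the probability space. -/

theorem proposition1 {Ω : Type*} [MeasurableSpace Ω] (P : Measure Ω) [IsProbabilityMeasure P]
    (n m : ℕ) (hn : 1 ≤ n) (hm : n + 2 ≤ m)
    (V : Fin m → Ω → EuclideanSpace ℝ (Fin n)) (W : Ω → Matrix (Fin n) (Fin n) ℝ)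
    (hVmeas : ∀ k, Measurable (V k)) (hWmeas : Measurable W)
    (hVlaw : ∀ k, HasLaw (V k) (multivariateGaussian 0 1) P)
    (hVindep : iIndepFun V P)
    (hVW : IndepFun (fun ω k => V k ω) W P)
    (hWskew : ∀ ω, W ω ∈ LieAlgebra.Orthogonal.so (Fin n) ℝ) :
    let 𝒱 : Ω → Matrix (Fin n) (Fin m) ℝ := fun ω => colMatrix fun k => V k ω
    let U : Fin m → Ω → EuclideanSpace ℝ (Fin n) :=
      fun k ω => sylvesterSol (fun l => V l ω) (W ω) k
    let 𝒰 : Ω → Matrix (Fin n) (Fin m) ℝ := fun ω => colMatrix fun k => U k ω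
    -- the `U k` are random vectors, almost surely well defined, and solve the equation
    (∀ k, Measurable (U k)) ∧
    (∀ᵐ ω ∂P, IsUnit (𝒱 ω * (𝒱 ω)ᵀ)) ∧
    (∀ᵐ ω ∂P, ∑ k, odot (U k ω) (V k ω) = W ω) ∧
    -- the moment bound, expectations being taken in `[0, ∞]`
    (∀ q : ℝ, 0 < q → q ≤ 2 →
      ∫⁻ ω, ENNReal.ofReal (‖𝒰 ω‖ ^ q) ∂P ≤
        ENNReal.ofReal (1 / (2 ^ q * (n : ℝ) ^ (q / 2))) *
          (∫⁻ ω, ENNReal.ofReal (((𝒱 ω * (𝒱 ω)ᵀ)⁻¹).trace ^ (q / 2)) ∂P) *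
          ∫⁻ ω, ENNReal.ofReal (‖W ω‖ ^ q) ∂P) ∧
    ∫⁻ ω, ENNReal.ofReal (‖𝒰 ω‖ ^ 2) ∂P ≤
      ENNReal.ofReal (1 / (4 * ((m : ℝ) - n - 1))) * ∫⁻ ω, ENNReal.ofReal (‖W ω‖ ^ 2) ∂P := by
  intro 𝒱 U 𝒰
  have : NeZero n := ⟨by omega⟩
  have hcard : Fintype.card (Fin n) + 2 ≤ Fintype.card (Fin m) := by simpa using hm
  set X : Ω → Fin m → Fin n → ℝ := fun ω k i => V k ω i with hX
  have hVX : ∀ ω, 𝒱 ω = (of (X ω))ᵀ := fun ω => rfl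
  have hXmeas : Measurable X := measurable_pi_lambda _ fun k => measurable_pi_lambda _ fun i =>
    (measurable_pi_apply i).comp ((WithLp.measurable_ofLp 2 _).comp (hVmeas k))
  have hofLp : MeasurePreserving (MeasurableEquiv.toLp 2 (Fin n → ℝ)).symm
      (stdGaussian (EuclideanSpace ℝ (Fin n))) (Measure.pi fun _ : Fin n => gaussianReal 0 1) :=
    MeasurePreserving.symm (MeasurableEquiv.toLp 2 (Fin n → ℝ))
      ⟨(MeasurableEquiv.toLp 2 (Fin n → ℝ)).measurable, map_pi_eq_stdGaussian⟩
  have hXlaw : P.map X = gaussianColumns (Fin n) (Fin m) := by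
    have h1 := (iIndepFun_iff_map_fun_eq_pi_map fun k => (hVmeas k).aemeasurable).1 hVindep
    simp only [(hVlaw _).map_eq, multivariateGaussian_zero_one] at h1
    have h2 := measurePreserving_pi (fun _ : Fin m => stdGaussian (EuclideanSpace ℝ (Fin n)))
      (fun _ => Measure.pi fun _ : Fin n => gaussianReal 0 1) fun _ => hofLp
    have h3 := h2.map_eq
    rw [← h1, Measure.map_map h2.measurable (measurable_pi_lambda _ hVmeas)] at h3
    exact h3
  have hXW : IndepFun X W P :=
    hVW.comp (φ := fun v k i => v k i) (measurable_pi_lambda _ fun k =>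
      measurable_pi_lambda _ fun i => (measurable_pi_apply i).comp
        ((WithLp.measurable_ofLp 2 _).comp (measurable_pi_apply k))) measurable_id
  have hWij : ∀ i j, Measurable fun w : Matrix (Fin n) (Fin n) ℝ => w i j := fun i j =>
    (measurable_pi_apply (X := fun _ => ℝ) j).comp
      (measurable_pi_apply (X := fun _ => Fin n → ℝ) i)
  have hXij : ∀ i k, Measurable fun x : Fin m → Fin n → ℝ => (of x)ᵀ i k := fun i k =>
    (measurable_pi_apply i).comp (measurable_pi_apply k)
  have hGm : ∀ i j, Measurable fun x : Fin m → Fin n → ℝ => ((of x)ᵀ * (of x)ᵀᵀ)⁻¹ i j :=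
    measurable_matrix_inv (measurable_matrix_mul hXij fun a b => hXij b a)
  have hU : ∀ ω, 𝒰 ω = sylvesterMatrix (of (X ω))ᵀ (W ω) := fun ω => rfl
  have hae : ∀ᵐ ω ∂P, IsUnit (𝒱 ω * (𝒱 ω)ᵀ) :=
    ae_of_ae_map hXmeas.aemeasurable (hXlaw ▸ ae_isUnit_gram hcard)
  have hbound : ∀ q : ℝ, 0 < q → q ≤ 2 →
      ∫⁻ ω, ENNReal.ofReal (‖𝒰 ω‖ ^ q) ∂P ≤
        ENNReal.ofReal (1 / (2 ^ q * (n : ℝ) ^ (q / 2))) *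
          (∫⁻ ω, ENNReal.ofReal (((𝒱 ω * (𝒱 ω)ᵀ)⁻¹).trace ^ (q / 2)) ∂P) *
          ∫⁻ ω, ENNReal.ofReal (‖W ω‖ ^ q) ∂P := by
    intro q hq0 hq2
    have hFm : Measurable fun p : (Fin m → Fin n → ℝ) × Matrix (Fin n) (Fin n) ℝ =>
        ENNReal.ofReal (‖sylvesterMatrix (of p.1)ᵀ p.2‖ ^ q) :=
      measurable_frobenius_norm_rpow (measurable_sylvesterMatrix
        (fun i k => (hXij i k).comp measurable_fst) fun i j => (hWij i j).comp measurable_snd) q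
    have hNm := measurable_frobenius_norm_rpow hWij q
    have hTm : Measurable fun x : Fin m → Fin n → ℝ =>
        ENNReal.ofReal (((of x)ᵀ * (of x)ᵀᵀ)⁻¹.trace ^ (q / 2)) :=
      ((measurable_matrix_trace hGm).pow_const _).ennreal_ofReal
    have hprod := (indepFun_iff_map_prod_eq_prod_map_map hXmeas.aemeasurable
      hWmeas.aemeasurable).1 hXW
    rw [hXlaw] at hprod
    have : IsProbabilityMeasure (P.map W) := Measure.isProbabilityMeasure_map hWmeas.aemeasurable
    simp only [hU, hVX]
    -- By independence the joint law is a product; Tonelli integrates over `X` first, with the value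
    -- of `W` fixed.
    rw [← lintegral_map hFm (hXmeas.prodMk hWmeas), hprod, lintegral_prod_symm' _ hFm,
      ← lintegral_map hTm hXmeas, hXlaw, ← lintegral_map hNm hWmeas,
      ← lintegral_const_mul _ hNm]
    exact lintegral_mono fun w => lintegral_sylvesterMatrix_le hq0 hq2 w
  refine ⟨fun k => ?_, hae, ?_, hbound, ?_⟩
  · exact (WithLp.measurable_toLp 2 _).comp (measurable_pi_lambda _ fun j =>
      measurable_sylvesterMatrix (fun i k => (hXij i k).comp hXmeas)
        (fun i j => (hWij i j).comp hWmeas) j k)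
  · filter_upwards [hae] with ω hω
    rw [sum_odot (fun k => U k ω) (fun k => V k ω)]
    exact sylvesterMatrix_solves hω ((LieAlgebra.Orthogonal.mem_so _ _ _).1 (hWskew ω))
  · have h1 : (0 : ℝ) < m - n - 1 := by
      have : (n : ℝ) + 2 ≤ m := by exact_mod_cast hm
      linarith
    have hn0 : (0 : ℝ) < n := by exact_mod_cast hn
    -- At `q = 2` the prefactor is `1 / (4n)`, and its `n` cancels against the expected inverse
    -- trace bound `n / (m - n - 1)`.
    have h2 := hbound 2 two_pos le_rfl
    simp only [Real.rpow_two, div_self (two_ne_zero' ℝ), Real.rpow_one] at h2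
    refine h2.trans (mul_le_mul_left ?_ _)
    have h3 := lintegral_trace_inv_gram_le (ι := Fin n) (κ := Fin m) hcard
    rw [← hXlaw, lintegral_map (measurable_matrix_trace hGm).ennreal_ofReal hXmeas] at h3
    refine (mul_le_mul_right h3 _).trans_eq ?_
    rw [← ENNReal.ofReal_mul (by positivity), Fintype.card_fin, Fintype.card_fin]
    congr 1
    field_simp
    norm_num
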